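/- For an integer $K \ge 0$, an integer $r \ge 0$ and nonnegative integers $\eta = (\eta_1,\dots,\eta_{K-1})$, let $D_{K,r}(\eta)$ be the set of tuples $\delta=(\delta_1,\dots,\delta_K)$ of nonnegative integers with $\sum_i \delta_i = r$ and $\delta_i \le \delta_{i+1}+\eta_i$ for $1 \le i \le K-1$. Put $\bar\lambda_i := \sum_{m=i}^{K-1} (2\eta_m+1)$, $\alpha_i := \delta_K + \sum_{m=i}^{K-1}\eta_m$ and $\beta_i := \alpha_i - \delta_i$ for $1 \le i \le K$, and let $$A_{K,r}(\eta) := r! \sum_{\delta \in D_{K,r}(\eta)} \det\left(\frac{1}{(\delta_j + \frac12(\bar\lambda_i - \bar\lambda_j - i + j))!}\right)_{1\le i,j\le K} \frac{\prod_{i<j}(\bar\lambda_i - \bar\lambda_j - 2\delta_i + 2\delta_j - i + j)}{\prod_{i<j}(\bar\lambda_i-\bar\lambda_j - i + j)},$$ where $1/m! := 0$ for negative integers $m$. For a partition $\nu$ of $r$ (zero parts allowed) let $f^\nu$ be the number of standard Young tableaux of shape $\nu$. Then, for all $K$ and $r$ (with $0^0 = 1$): 1. $$\frac{r!}{\prod_{i=1}^K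 (i-1)!}\ \sum_{\substack{0\le \delta_1\le\dots\le\delta_K\\ \sum_i\delta_i = r}}\ \frac{\prod_{1\le i<j\le K}(\delta_j-\delta_i+j-i)^2}{\prod_{i=1}^K(\delta_i+i-1)!} = K^r .$$ 2. The left side of this identity is the case $\eta = 0$ of $A_{K,r}(\eta)$: the set $D_{K,r}(0)$ consists of the tuples $0 \le \delta_1\le\dots\le\delta_K$ with $\sum_i \delta_i = r$, and $A_{K,r}(0)$ equals the left side in 1. 3. For $\eta = 0$ and every such $\delta$, the number of standard skew tableaux of shape $\alpha/\beta$, and $r!$ times the determinant above, both equal $f^{(\delta_K,\dots,\delta_1)}$, and $$f^{(\delta_K,\dots,\delta_1)} = \frac{r!\,\prod_{i<j}(\delta_j-\delta_i+j-i)}{\prod_i(\delta_i+i-1)!}.$$ 4. In the case $K=2$, written out with $\delta_1 = q$ and $\delta_2 = r-q$, $$r!\sum_{q=0}^{\lfloor r/2\rfloor}\frac{(r-2q+1)^2}{q!\,(r-q+1)!} = 2^r .$$ -/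

import Mathlib

open Finset
open scoped Nat

/-- The tuples `δ = (δ_1, …, δ_K)` of nonnegative integers with `δ_1 + ⋯ + δ_K = r` and
`δ_i ≤ δ_{i+1} + η_i` for `1 ≤ i ≤ K - 1`. Positions are numbered from `0` in `Fin K`;
the last entry of `η` plays no role. -/
def admissible (K : ℕ) (η : Fin K → ℕ) (r : ℕ) : Finset (Fin K → ℕ) :=
  (Finset.Nat.antidiagonalTuple K r).filter
    (fun δ => ∀ i j : Fin K, (i : ℕ) + 1 = (j : ℕ) → δ i ≤ δ j + η i)

/-- The tuples `0 ≤ δ_1 ≤ ⋯ ≤ δ_K` of integers with `δ_1 + ⋯ + δ_K = r`. -/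
def increasingTuples (K r : ℕ) : Finset (Fin K → ℕ) :=
  (Finset.Nat.antidiagonalTuple K r).filter (fun δ => ∀ i j : Fin K, i ≤ j → δ i ≤ δ j)

/-- A standard tableau of skew shape `α / β`, where `β_i ≤ α_i` are the row lengths: a labeling
of the boxes `(i, j)`, `β_i ≤ j < α_i` (columns numbered from `0`), by the `r` labels of `Fin r`,
each used once, that increases along every row and every column. -/
structure StandardSkewTableau {K : ℕ} (α β : Fin K → ℕ) (r : ℕ) where
  label : {c : Fin K × ℕ // β c.1 ≤ c.2 ∧ c.2 < α c.1} ≃ Fin r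
  row_increasing : ∀ c d, c.1.1 = d.1.1 → c.1.2 < d.1.2 → label c < label d
  col_increasing : ∀ c d, c.1.2 = d.1.2 → c.1.1 < d.1.1 → label c < label d

/-- The number of standard tableaux of skew shape `α / β` with `r` boxes. -/
noncomputable def skewCount {K : ℕ} (α β : Fin K → ℕ) (r : ℕ) : ℕ :=
  Nat.card (StandardSkewTableau α β r)

/-- The number `f^ν` of standard Young tableaux of shape `ν` with `r` boxes; parts of `ν` equal to
`0` are allowed. -/
noncomputable def youngCount {K : ℕ} (ν : Fin K → ℕ) (r : ℕ) : ℕ :=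
  skewCount ν (fun _ => 0) r

/-- The last entry `δ_K` (and `0` for the empty tuple). -/
def lastEntry {K : ℕ} (δ : Fin K → ℕ) : ℕ :=
  if h : 0 < K then δ ⟨K - 1, Nat.sub_lt h Nat.one_pos⟩ else 0

/-- The outer shape: `α_i = δ_K + η_{K-1} + ⋯ + η_i` for `i < K`, and `α_K = δ_K`. -/
def outerShape {K : ℕ} (η δ : Fin K → ℕ) (i : Fin K) : ℕ :=
  lastEntry δ + ∑ m : Fin K with i ≤ m ∧ (m : ℕ) + 1 < K, η m

/-- The inner shape: `β_i = α_i - δ_i`, which is `0` for `i = K`. The difference is nonnegative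
for every admissible `δ`. -/
def innerShape {K : ℕ} (η δ : Fin K → ℕ) (i : Fin K) : ℕ :=
  outerShape η δ i - δ i

/-- The tuple with last entry `0` and consecutive differences `2 η_i + 1`. -/
def barLambda {K : ℕ} (η : Fin K → ℕ) (i : Fin K) : ℤ :=
  ∑ m : Fin K with i ≤ m ∧ (m : ℕ) + 1 < K, (2 * (η m : ℤ) + 1)

/-- `1 / m!`, understood as `0` if `m` is a negative integer. -/
def invFactorial (m : ℤ) : ℚ :=
  if 0 ≤ m then 1 / ((m.toNat)! : ℚ) else 0

/-- The matrix with entries `1 / (δ_j + (λ_i - λ_j - i + j) / 2)!`, for `λ = barLambda η`.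
The division by `2` is exact. -/
def skewMatrix {K : ℕ} (η δ : Fin K → ℕ) : Matrix (Fin K) (Fin K) ℚ :=
  Matrix.of fun i j =>
    invFactorial ((δ j : ℤ) + (barLambda η i - barLambda η j - (i : ℤ) + (j : ℤ)) / 2)

/-- The left side of the first (general) identity, with parameters `η_1, …, η_{K-1}`. -/
def firstIdentitySum (K : ℕ) (η : Fin K → ℕ) (r : ℕ) : ℚ :=
  (r ! : ℚ) * ∑ δ ∈ admissible K η r,
    (skewMatrix η δ).det *
      ((∏ i : Fin K, ∏ j ∈ Finset.Ioi i,
          ((barLambda η i : ℚ) - barLambda η j - 2 * (δ i : ℚ) + 2 * (δ j : ℚ) - (i : ℕ) + (j : ℕ))) /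
        ∏ i : Fin K, ∏ j ∈ Finset.Ioi i,
          ((barLambda η i : ℚ) - barLambda η j - (i : ℕ) + (j : ℕ)))

/-- The left side of the second identity. With positions numbered from `0`, the factorials
`(i - 1)!` and `(δ_i + i - 1)!` become `i !` and `(δ i + i)!`. -/
def secondIdentitySum (K r : ℕ) : ℚ :=
  (r ! : ℚ) / (∏ i : Fin K, ((i : ℕ)! : ℚ)) * ∑ δ ∈ increasingTuples K r,
    (∏ i : Fin K, ∏ j ∈ Finset.Ioi i, ((δ j : ℚ) - (δ i : ℚ) + (j : ℕ) - (i : ℕ)) ^ 2) /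
      ∏ i : Fin K, ((δ i + (i : ℕ))! : ℚ)

/-!
Put `l_i = δ_i + i` (positions numbered from `0`), let `Δ(l)` be the Vandermonde determinant of `l`
and `e_i` the `i`-th unit vector. Everything rests on two identities for `K` variables:

* `∑_i Δ(l + e_i) = K Δ(l)` (`sum_det_vandermonde_add_one`),
* `∑_i l_i Δ(l - e_i) = (∑_i (l_i - i)) Δ(l)` (`sum_mul_det_vandermonde_sub_one`).

Both are instances of `∑_i det (V with row i replaced by row i of V * A) = tr A * det V`
(`Matrix.sum_det_updateRow_mul`), with `V` the Vandermonde matrix and `A` the triangular matrix of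
the operator `p(x) ↦ p(x + 1)`, respectively `p(x) ↦ x (p(x - 1) - p(x))`, in the basis `x^j`.

Deleting the box of the largest label shows that the number of standard tableaux of a shape is the
sum of these numbers over the shapes with one corner removed (`youngCount_succ`). The product
`r! Δ(l) / ∏ l_i!` satisfies the same recurrence by the second identity, in which the summands that
do not belong to a corner vanish; hence it counts the standard tableaux (`youngCount_rev_eq`).

For `∑_δ Δ(l)^2 / ∏ l_i!` the recurrence is applied to one of the two factors `Δ(l)`. Exchanging the
summations over a partition of `r + 1` and a corner of it for those over a partition of `r` and a
box added to it, and applying the first identity to the other factor, one gets a factor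
`K / (r + 1)` at each step (`sum_sq_shiftedVandermonde_succ`), whence the power `K ^ r`.

For `η = 0` the determinant of `1 / (l_j - i)!` is `∏ 1 / l_j!` times a determinant of falling
factorials, which are monic, so that it is again `Δ(l)` (`det_skewMatrix_zero`); and the skew shape
is the partition shape turned by 180 degrees (`skewCount_rotate`).
-/

/-! ### Shifting one variable of a Vandermonde determinant -/

/-- By Cramer's rule the `i`-th determinant is the `i`-th diagonal entry of `V * A * adjugate V`, a
matrix whose trace is that of `A * (adjugate V * V)`. -/
theorem Matrix.sum_det_updateRow_mul {R n : Type*} [CommRing R] [Fintype n] [DecidableEq n]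
    (V A : Matrix n n R) :
    ∑ i, (V.updateRow i ((V * A) i)).det = A.trace * V.det := by
  have h : ∀ i, (V.updateRow i ((V * A) i)).det = (V * A * V.adjugate) i i := by
    intro i
    rw [← Matrix.cramer_transpose_apply, Matrix.cramer_eq_adjugate_mulVec,
      ← Matrix.adjugate_transpose, Matrix.mulVec_transpose, ← Matrix.mul_apply_eq_vecMul]
  calc ∑ i, (V.updateRow i ((V * A) i)).det = (V * A * V.adjugate).trace := by
        simp only [h, Matrix.trace, Matrix.diag]
    _ = (A * (V.adjugate * V)).trace := by
        rw [Matrix.mul_assoc, Matrix.trace_mul_comm, Matrix.mul_assoc]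
    _ = A.trace * V.det := by
        rw [Matrix.adjugate_mul, Matrix.mul_smul, Matrix.mul_one, Matrix.trace_smul, smul_eq_mul,
          mul_comm]

/-- Replacing each row `v_i^j` in turn by `P_j(v_i)`: if the `P_j` have degree less than `K`, they
are combinations of the columns, and the trace of the coefficient matrix appears. -/
theorem sum_det_updateRow_vandermonde_eval {K : ℕ} (v : Fin K → ℚ) (P : Fin K → Polynomial ℚ)
    (hP : ∀ j, (P j).natDegree < K) :
    ∑ i, ((Matrix.vandermonde v).updateRow i (fun j => (P j).eval (v i))).det =
      (∑ j, (P j).coeff j) * (Matrix.vandermonde v).det := by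
  have h := Matrix.sum_det_updateRow_mul (Matrix.vandermonde v)
    (Matrix.of fun m j : Fin K => (P j).coeff m)
  have hrow : ∀ i, (Matrix.vandermonde v * Matrix.of fun m j : Fin K => (P j).coeff m) i =
      fun j => (P j).eval (v i) := by
    intro i
    ext j
    rw [Matrix.mul_apply, Polynomial.eval_eq_sum_range' (hP j), Finset.sum_range]
    exact Finset.sum_congr rfl fun m _ => by simp [Matrix.vandermonde_apply, mul_comm]
  simpa only [hrow, Matrix.trace, Matrix.diag, Matrix.of_apply] using h

theorem vandermonde_update {K : ℕ} (v : Fin K → ℚ) (i : Fin K) (a : ℚ) :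
    Matrix.vandermonde (Function.update v i a) =
      (Matrix.vandermonde v).updateRow i (fun j => a ^ (j : ℕ)) := by
  ext k j
  by_cases h : k = i
  · subst h; simp [Matrix.vandermonde_apply]
  · simp [Matrix.vandermonde_apply, h]

theorem sum_det_vandermonde_add_one {K : ℕ} (v : Fin K → ℚ) :
    ∑ i, (Matrix.vandermonde (Function.update v i (v i + 1))).det =
      K * (Matrix.vandermonde v).det := by
  have h := sum_det_updateRow_vandermonde_eval v
    (fun j => (Polynomial.X + Polynomial.C 1) ^ (j : ℕ)) (fun j => by
      rw [Polynomial.natDegree_pow_X_add_C]; exact j.2)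
  simpa [vandermonde_update, Polynomial.coeff_X_add_one_pow] using h

theorem natDegree_X_mul_sub_one_pow_sub_lt {K : ℕ} (j : Fin K) :
    (Polynomial.X * ((Polynomial.X - 1) ^ (j : ℕ) - Polynomial.X ^ (j : ℕ)) :
      Polynomial ℚ).natDegree < K := by
  rcases Nat.eq_zero_or_pos (j : ℕ) with hj | hj
  · simpa [hj] using j.pos
  · refine lt_of_le_of_lt ?_ j.2
    rw [Polynomial.natDegree_le_iff_coeff_eq_zero]
    intro N hN
    obtain ⟨m, rfl⟩ : ∃ m, N = m + 1 := ⟨N - 1, by omega⟩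
    have e : (Polynomial.X - 1 : Polynomial ℚ) = Polynomial.X + Polynomial.C (-1) := by
      simp [sub_eq_add_neg]
    rw [Polynomial.coeff_X_mul, Polynomial.coeff_sub, e, Polynomial.coeff_X_add_C_pow,
      Polynomial.coeff_X_pow]
    rcases Nat.lt_or_ge (j : ℕ) m with h | h
    · simp [Nat.choose_eq_zero_of_lt h, h.ne']
    · have : m = (j : ℕ) := by omega
      simp [this]

theorem coeff_X_mul_sub_one_pow_sub (j : ℕ) :
    (Polynomial.X * ((Polynomial.X - 1) ^ j - Polynomial.X ^ j) : Polynomial ℚ).coeff j = -j := by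
  cases j with
  | zero => simp
  | succ j =>
    have e : (Polynomial.X - 1 : Polynomial ℚ) = Polynomial.X + Polynomial.C (-1) := by
      simp [sub_eq_add_neg]
    rw [Polynomial.coeff_X_mul, Polynomial.coeff_sub, e, Polynomial.coeff_X_add_C_pow,
      Polynomial.coeff_X_pow]
    simp

theorem sum_mul_det_vandermonde_sub_one {K : ℕ} (v : Fin K → ℚ) :
    ∑ i, v i * (Matrix.vandermonde (Function.update v i (v i - 1))).det =
      (∑ i, (v i - (i : ℕ))) * (Matrix.vandermonde v).det := by
  have h := sum_det_updateRow_vandermonde_eval v _ natDegree_X_mul_sub_one_pow_sub_lt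
  simp only [coeff_X_mul_sub_one_pow_sub] at h
  have hdet : ∀ i, ((Matrix.vandermonde v).updateRow i (fun j : Fin K =>
      (Polynomial.X * ((Polynomial.X - 1) ^ (j : ℕ) - Polynomial.X ^ (j : ℕ)) :
        Polynomial ℚ).eval (v i))).det =
      v i * (Matrix.vandermonde (Function.update v i (v i - 1))).det -
        v i * (Matrix.vandermonde v).det := by
    intro i
    have hself : (Matrix.vandermonde v).det =
        ((Matrix.vandermonde v).updateRow i (fun j => v i ^ (j : ℕ))).det := by
      rw [← vandermonde_update, Function.update_eq_self]
    have hfun : (fun j : Fin K => (Polynomial.X * ((Polynomial.X - 1) ^ (j : ℕ) -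
        Polynomial.X ^ (j : ℕ)) : Polynomial ℚ).eval (v i)) =
        v i • ((fun j : Fin K => (v i - 1) ^ (j : ℕ)) +
          (-1 : ℚ) • fun j : Fin K => v i ^ (j : ℕ)) := by
      ext j
      simp [sub_eq_add_neg]
    rw [hfun, Matrix.det_updateRow_smul, Matrix.det_updateRow_add, Matrix.det_updateRow_smul,
      ← hself, ← vandermonde_update]
    ring
  simp only [hdet, Finset.sum_sub_distrib, ← Finset.sum_mul] at h
  rw [Finset.sum_sub_distrib, sub_mul]
  rw [Finset.sum_neg_distrib] at h
  linarith

/-! ### Skew tableaux and their rotation -/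

namespace StandardSkewTableau

variable {K r : ℕ} {α β : Fin K → ℕ}

@[ext]
theorem ext {S T : StandardSkewTableau α β r} (h : ∀ c, S.label c = T.label c) : S = T := by
  cases S; cases T
  congr
  exact Equiv.ext h

instance : Finite (StandardSkewTableau α β r) := by
  rcases isEmpty_or_nonempty (StandardSkewTableau α β r) with h | ⟨⟨T⟩⟩
  · infer_instance
  · have := Finite.of_equiv _ T.label.symm
    exact Finite.of_injective (fun S : StandardSkewTableau α β r => S.label)
      fun S T h => ext fun c => by rw [show S.label = T.label from h]

end StandardSkewTableau

/-- Rotation by 180 degrees inside the rectangle with rows of length `m` takes the boxes of `α / β`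
to those of `α' / β'`. The hypotheses say that the two shapes correspond. -/
def rotateCells {K : ℕ} (α β α' β' : Fin K → ℕ) (m : ℕ)
    (hα : ∀ i, α i + β' i.rev = m) (hβ : ∀ i, β i + α' i.rev = m) :
    {c : Fin K × ℕ // β c.1 ≤ c.2 ∧ c.2 < α c.1} ≃
      {c : Fin K × ℕ // β' c.1 ≤ c.2 ∧ c.2 < α' c.1} where
  toFun c := ⟨(c.1.1.rev, m - 1 - c.1.2), by
    have := hα c.1.1; have := hβ c.1.1; have := c.2; dsimp only; omega⟩
  invFun c := ⟨(c.1.1.rev, m - 1 - c.1.2), by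
    have h1 := hα c.1.1.rev; have h2 := hβ c.1.1.rev; have := c.2
    rw [Fin.rev_rev] at h1 h2; dsimp only; omega⟩
  left_inv c := by
    have := hα c.1.1; have := c.2
    ext <;> simp
    omega
  right_inv c := by
    have h := hβ c.1.1.rev; have := c.2
    rw [Fin.rev_rev] at h
    ext <;> simp
    omega

/-- The rotation of a tableau by 180 degrees, with the order of the labels reversed. -/
def StandardSkewTableau.rotate {K r : ℕ} {α β α' β' : Fin K → ℕ} (m : ℕ)
    (hα : ∀ i, α i + β' i.rev = m) (hβ : ∀ i, β i + α' i.rev = m)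
    (T : StandardSkewTableau α' β' r) : StandardSkewTableau α β r where
  label := ((rotateCells α β α' β' m hα hβ).trans T.label).trans Fin.revPerm
  row_increasing c d h1 h2 := by
    have := hα c.1.1; have := hα d.1.1; have := c.2; have := d.2
    simp only [Equiv.trans_apply, Fin.revPerm_apply, Fin.rev_lt_rev]
    refine T.row_increasing _ _ ?_ ?_
    · simp [rotateCells, h1]
    · simp only [rotateCells, Equiv.coe_fn_mk]; omega
  col_increasing c d h1 h2 := by
    simp only [Equiv.trans_apply, Fin.revPerm_apply, Fin.rev_lt_rev]
    refine T.col_increasing _ _ ?_ ?_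
    · simp [rotateCells, h1]
    · simpa only [rotateCells, Equiv.coe_fn_mk, ← Fin.lt_def, Fin.rev_lt_rev] using h2

/-- A skew shape and the same shape turned by 180 degrees have equally many standard tableaux. -/
theorem skewCount_rotate {K : ℕ} (r : ℕ) {α β α' β' : Fin K → ℕ} (m : ℕ)
    (hα : ∀ i, α i + β' i.rev = m) (hβ : ∀ i, β i + α' i.rev = m) :
    skewCount α β r = skewCount α' β' r := by
  have hα' : ∀ i, α' i + β i.rev = m := fun i => by
    have := hβ i.rev; rw [Fin.rev_rev] at this; omega
  have hβ' : ∀ i, β' i + α i.rev = m := fun i => by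
    have := hα i.rev; rw [Fin.rev_rev] at this; omega
  refine Nat.card_congr
    { toFun := StandardSkewTableau.rotate m hα' hβ'
      invFun := StandardSkewTableau.rotate m hα hβ
      left_inv := fun T => ?_
      right_inv := fun T => ?_ }
  · ext c
    have : rotateCells α' β' α β m hα' hβ' (rotateCells α β α' β' m hα hβ c) = c :=
      (rotateCells α β α' β' m hα hβ).left_inv c
    simp [StandardSkewTableau.rotate, this]
  · ext c
    have : rotateCells α β α' β' m hα hβ (rotateCells α' β' α β m hα' hβ' c) = c :=
      (rotateCells α' β' α β m hα' hβ').left_inv c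
    simp [StandardSkewTableau.rotate, this]

/-! ### Removing the largest label -/

namespace StandardSkewTableau

variable {K r : ℕ} {ν : Fin K → ℕ}

/-- The box that carries the largest label. -/
def lastBox {α β : Fin K → ℕ} (T : StandardSkewTableau α β (r + 1)) :
    {c : Fin K × ℕ // β c.1 ≤ c.2 ∧ c.2 < α c.1} :=
  T.label.symm (Fin.last r)

theorem label_lastBox {α β : Fin K → ℕ} (T : StandardSkewTableau α β (r + 1)) :
    T.label T.lastBox = Fin.last r :=
  T.label.apply_symm_apply _

/-- The box of the largest label is the last one in its row. -/
theorem lastBox_snd {β : Fin K → ℕ} (T : StandardSkewTableau ν β (r + 1)) :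
    T.lastBox.1.2 + 1 = ν T.lastBox.1.1 := by
  by_contra hne
  have hc := T.lastBox.2
  have h := T.row_increasing T.lastBox
    ⟨(T.lastBox.1.1, T.lastBox.1.2 + 1), by dsimp only; omega⟩ rfl (Nat.lt_succ_self _)
  rw [label_lastBox] at h
  exact absurd h (Fin.le_last _).not_gt

/-- The rows below the box of the largest label do not reach its column. -/
theorem lt_of_lastBox {T : StandardSkewTableau ν (fun _ => 0) (r + 1)} {j : Fin K}
    (hj : T.lastBox.1.1 < j) : ν j < ν T.lastBox.1.1 := by
  by_contra hge
  have hc := T.lastBox.2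
  have h := T.col_increasing T.lastBox
    ⟨(j, T.lastBox.1.2), by dsimp only; omega⟩ rfl hj
  rw [label_lastBox] at h
  exact absurd h (Fin.le_last _).not_gt

theorem mem_of_mem_update {i : Fin K} {c : Fin K × ℕ}
    (h : 0 ≤ c.2 ∧ c.2 < Function.update ν i (ν i - 1) c.1) :
    0 ≤ c.2 ∧ c.2 < ν c.1 := by
  rcases eq_or_ne c.1 i with rfl | hi
  · rw [Function.update_self] at h; omega
  · rwa [Function.update_of_ne hi] at h

theorem mem_update_of_mem {i : Fin K} {c : Fin K × ℕ} (h : 0 ≤ c.2 ∧ c.2 < ν c.1)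
    (hc : c ≠ (i, ν i - 1)) : 0 ≤ c.2 ∧ c.2 < Function.update ν i (ν i - 1) c.1 := by
  rcases eq_or_ne c.1 i with rfl | hi
  · rw [Function.update_self]
    have : c.2 ≠ ν c.1 - 1 := fun h => hc (Prod.ext rfl h)
    omega
  · rwa [Function.update_of_ne hi]

theorem ne_of_mem_update {i : Fin K} {c : Fin K × ℕ}
    (h : 0 ≤ c.2 ∧ c.2 < Function.update ν i (ν i - 1) c.1) : c ≠ (i, ν i - 1) := by
  rintro rfl
  simp at h

theorem lastBox_eq {i : Fin K} {T : StandardSkewTableau ν (fun _ => 0) (r + 1)}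
    (h : T.lastBox.1.1 = i) : T.lastBox.1 = (i, ν i - 1) := by
  have := T.lastBox_snd
  rw [h] at this
  exact Prod.ext h (by dsimp only; omega)

theorem label_ne_last {i : Fin K} {T : StandardSkewTableau ν (fun _ => 0) (r + 1)}
    (h : T.lastBox.1.1 = i) {c} (hc : c.1 ≠ (i, ν i - 1)) : T.label c ≠ Fin.last r := by
  intro hl
  apply hc
  rw [← lastBox_eq h, lastBox, ← hl, Equiv.symm_apply_apply]

/-- Deleting the box of the largest label, which is the last box of row `i`. -/
def removeLast {i : Fin K} (T : StandardSkewTableau ν (fun _ => 0) (r + 1))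
    (h : T.lastBox.1.1 = i) :
    StandardSkewTableau (Function.update ν i (ν i - 1)) (fun _ => 0) r where
  label :=
    { toFun := fun c => (T.label ⟨c.1, mem_of_mem_update c.2⟩).castPred
        (label_ne_last h (ne_of_mem_update c.2))
      invFun := fun k => ⟨(T.label.symm k.castSucc).1,
        mem_update_of_mem (T.label.symm k.castSucc).2 fun hc => by
          have : T.label.symm k.castSucc = T.lastBox := Subtype.ext (hc.trans (lastBox_eq h).symm)
          rw [lastBox, T.label.symm.apply_eq_iff_eq] at this
          exact (Fin.castSucc_lt_last k).ne this⟩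
      left_inv := fun c => by simp
      right_inv := fun k => by simp }
  row_increasing c d h1 h2 := by
    simpa using T.row_increasing ⟨c.1, mem_of_mem_update c.2⟩ ⟨d.1, mem_of_mem_update d.2⟩ h1 h2
  col_increasing c d h1 h2 := by
    simpa using T.col_increasing ⟨c.1, mem_of_mem_update c.2⟩ ⟨d.1, mem_of_mem_update d.2⟩ h1 h2

/-- Adding a box with a new largest label at the end of row `i`. -/
def addLast {i : Fin K} (hi : 0 < ν i) (hcorner : ∀ j, i < j → ν j < ν i)
    (T : StandardSkewTableau (Function.update ν i (ν i - 1)) (fun _ => 0) r) :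
    StandardSkewTableau ν (fun _ => 0) (r + 1) where
  label :=
    { toFun := fun c => if h : c.1 = (i, ν i - 1) then Fin.last r
        else (T.label ⟨c.1, mem_update_of_mem c.2 h⟩).castSucc
      invFun := Fin.lastCases ⟨(i, ν i - 1), by dsimp only; omega⟩
        fun k => ⟨(T.label.symm k).1, mem_of_mem_update (T.label.symm k).2⟩
      left_inv := fun c => by
        by_cases h : c.1 = (i, ν i - 1)
        · simp only [h, dite_true, Fin.lastCases_last]
          exact Subtype.ext h.symm
        · simp [h]
      right_inv := fun k => by
        cases k using Fin.lastCases with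
        | last => simp
        | cast k => simp [ne_of_mem_update (T.label.symm k).2] }
  row_increasing c d h1 h2 := by
    have hc : c.1 ≠ (i, ν i - 1) := fun h => by
      have := d.2.2
      rw [← h1, h] at this
      rw [h] at h2
      dsimp only at *
      omega
    by_cases hd : d.1 = (i, ν i - 1)
    · simp [hc, hd, Fin.castSucc_lt_last]
    · simpa [hc, hd] using T.row_increasing ⟨c.1, mem_update_of_mem c.2 hc⟩
        ⟨d.1, mem_update_of_mem d.2 hd⟩ h1 h2
  col_increasing c d h1 h2 := by
    have hc : c.1 ≠ (i, ν i - 1) := fun h => by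
      have := d.2.2
      rw [← h1, h] at this
      rw [h] at h2
      have := hcorner _ h2
      dsimp only at *
      omega
    by_cases hd : d.1 = (i, ν i - 1)
    · simp [hc, hd, Fin.castSucc_lt_last]
    · simpa [hc, hd] using T.col_increasing ⟨c.1, mem_update_of_mem c.2 hc⟩
        ⟨d.1, mem_update_of_mem d.2 hd⟩ h1 h2

theorem lastBox_addLast {i : Fin K} (hi : 0 < ν i) (hcorner : ∀ j, i < j → ν j < ν i)
    (T : StandardSkewTableau (Function.update ν i (ν i - 1)) (fun _ => 0) r) :
    (addLast hi hcorner T).lastBox.1.1 = i := by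
  change ((Fin.lastCases _ _ (Fin.last r) : {c : Fin K × ℕ // 0 ≤ c.2 ∧ c.2 < ν c.1})).1.1 = i
  rw [Fin.lastCases_last]

/-- For a corner in row `i`, the tableaux with the largest label in row `i` correspond to the
tableaux of the shape without that corner. -/
def fiberEquiv {i : Fin K} (hi : 0 < ν i) (hcorner : ∀ j, i < j → ν j < ν i) :
    {T : StandardSkewTableau ν (fun _ => 0) (r + 1) // T.lastBox.1.1 = i} ≃
      StandardSkewTableau (Function.update ν i (ν i - 1)) (fun _ => 0) r where
  toFun T := T.1.removeLast T.2
  invFun T := ⟨addLast hi hcorner T, lastBox_addLast hi hcorner T⟩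
  left_inv T := by
    apply Subtype.ext
    ext c
    by_cases h : c.1 = (i, ν i - 1)
    · have hc : c = T.1.lastBox := Subtype.ext (h.trans (lastBox_eq T.2).symm)
      have : T.1.label c = Fin.last r := by rw [hc, label_lastBox]
      simp [addLast, h, this]
    · simp [addLast, removeLast, h]
  right_inv T := by
    ext c
    simp [addLast, removeLast, ne_of_mem_update c.2]

end StandardSkewTableau

open Classical in
/-- Sorting the tableaux by the row of the largest label, which ends in a corner of the shape. The
parts of `ν` need not be decreasing here. -/
theorem youngCount_succ {K : ℕ} (ν : Fin K → ℕ) (r : ℕ) :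
    youngCount ν (r + 1) = ∑ i : Fin K,
      if 0 < ν i ∧ ∀ j, i < j → ν j < ν i then
        youngCount (Function.update ν i (ν i - 1)) r else 0 := by
  have h : youngCount ν (r + 1) = ∑ i : Fin K,
      Nat.card {T : StandardSkewTableau ν (fun _ => 0) (r + 1) // T.lastBox.1.1 = i} := by
    rw [← Nat.card_sigma, youngCount, skewCount]
    exact Nat.card_congr (Equiv.sigmaFiberEquiv _).symm
  rw [h]
  refine Finset.sum_congr rfl fun i _ => ?_
  split_ifs with hi
  · exact Nat.card_congr (StandardSkewTableau.fiberEquiv hi.1 hi.2)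
  · have : IsEmpty {T : StandardSkewTableau ν (fun _ => 0) (r + 1) // T.lastBox.1.1 = i} := by
      refine ⟨fun ⟨T, hT⟩ => hi ⟨?_, fun j hj => ?_⟩⟩
      · have := T.lastBox_snd
        rw [hT] at this
        omega
      · subst hT
        exact StandardSkewTableau.lt_of_lastBox hj
    exact Nat.card_of_isEmpty

theorem youngCount_zero {K : ℕ} : youngCount (fun _ : Fin K => 0) 0 = 1 := by
  rw [youngCount, skewCount, Nat.card_eq_one_iff_unique]
  have : IsEmpty {c : Fin K × ℕ // 0 ≤ c.2 ∧ c.2 < 0} := ⟨fun c => absurd c.2.2 (Nat.not_lt_zero _)⟩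
  exact ⟨⟨fun S T => StandardSkewTableau.ext fun c => isEmptyElim c⟩,
    ⟨⟨Equiv.equivOfIsEmpty _ _, fun c => isEmptyElim c, fun c => isEmptyElim c⟩⟩⟩

/-! ### The Vandermonde determinant of a partition -/

/-- The strictly increasing sequence `δ_i + i`. -/
def shiftedParts {K : ℕ} (δ : Fin K → ℕ) (i : Fin K) : ℚ :=
  (δ i : ℚ) + (i : ℕ)

/-- The Vandermonde determinant of the sequence `δ_i + i`. -/
def shiftedVandermonde {K : ℕ} (δ : Fin K → ℕ) : ℚ :=
  (Matrix.vandermonde (shiftedParts δ)).det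

/-- The product of the factorials `(δ_i + i)!`. -/
def shiftedFactorial {K : ℕ} (δ : Fin K → ℕ) : ℚ :=
  ∏ i : Fin K, ((δ i + (i : ℕ))! : ℚ)

theorem shiftedFactorial_ne_zero {K : ℕ} (δ : Fin K → ℕ) : shiftedFactorial δ ≠ 0 :=
  Finset.prod_ne_zero_iff.2 fun _ _ => Nat.cast_ne_zero.2 (Nat.factorial_ne_zero _)

theorem shiftedVandermonde_eq_prod {K : ℕ} (δ : Fin K → ℕ) :
    shiftedVandermonde δ =
      ∏ i : Fin K, ∏ j ∈ Finset.Ioi i, ((δ j : ℚ) - (δ i : ℚ) + (j : ℕ) - (i : ℕ)) := by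
  rw [shiftedVandermonde, Matrix.det_vandermonde]
  refine Finset.prod_congr rfl fun i _ => Finset.prod_congr rfl fun j _ => ?_
  rw [shiftedParts, shiftedParts]
  ring

theorem shiftedParts_update {K : ℕ} (δ : Fin K → ℕ) (i : Fin K) (a : ℕ) :
    shiftedParts (Function.update δ i a) =
      Function.update (shiftedParts δ) i ((a : ℚ) + (i : ℕ)) := by
  ext j
  rcases eq_or_ne j i with rfl | h
  · simp [shiftedParts]
  · simp [shiftedParts, h]

theorem shiftedFactorial_update_succ {K : ℕ} (δ : Fin K → ℕ) (i : Fin K) :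
    shiftedFactorial (Function.update δ i (δ i + 1)) =
      (shiftedParts δ i + 1) * shiftedFactorial δ := by
  rw [shiftedFactorial, shiftedFactorial, ← Finset.mul_prod_erase _ _ (Finset.mem_univ i),
    ← Finset.mul_prod_erase _ (fun k : Fin K => ((δ k + (k : ℕ))! : ℚ)) (Finset.mem_univ i),
    ← mul_assoc]
  congr 1
  · rw [Function.update_self, add_right_comm, Nat.factorial_succ, shiftedParts]
    push_cast
    ring
  · refine Finset.prod_congr rfl fun k hk => ?_
    rw [Function.update_of_ne (Finset.ne_of_mem_erase hk)]

theorem det_vandermonde_update_eq_zero {K : ℕ} (v : Fin K → ℚ) {i j : Fin K} (h : i ≠ j) :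
    (Matrix.vandermonde (Function.update v i (v j))).det = 0 :=
  Matrix.det_vandermonde_eq_zero_iff.2 ⟨i, j, by simp [h.symm], h⟩

theorem sum_shiftedVandermonde_update_succ {K : ℕ} (δ : Fin K → ℕ) :
    ∑ i, shiftedVandermonde (Function.update δ i (δ i + 1)) = K * shiftedVandermonde δ := by
  rw [shiftedVandermonde, ← sum_det_vandermonde_add_one]
  refine Finset.sum_congr rfl fun i _ => ?_
  rw [shiftedVandermonde, shiftedParts_update]
  congr 3
  rw [shiftedParts]
  push_cast
  ring

/-! ### Adding and removing boxes -/

/-- A box may be removed from row `i` of the partition whose parts are the entries of `δ`. -/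
def IsRemovable {K : ℕ} (δ : Fin K → ℕ) (i : Fin K) : Prop :=
  0 < δ i ∧ ∀ j, j < i → δ j < δ i

theorem Monotone.isRemovable_update_succ {K : ℕ} {δ : Fin K → ℕ} (hδ : Monotone δ) (i : Fin K) :
    IsRemovable (Function.update δ i (δ i + 1)) i := by
  refine ⟨by simp, fun j hj => ?_⟩
  rw [Function.update_self, Function.update_of_ne hj.ne]
  exact Nat.lt_succ_of_le (hδ hj.le)

theorem Monotone.update_pred {K : ℕ} {δ : Fin K → ℕ} (hδ : Monotone δ) {i : Fin K}
    (hi : IsRemovable δ i) : Monotone (Function.update δ i (δ i - 1)) := by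
  intro a b hab
  have := hδ hab
  simp only [Function.update_apply]
  split_ifs with ha hb hb
  · rfl
  · subst ha
    omega
  · subst hb
    have := hi.2 a (lt_of_le_of_ne hab ha)
    omega
  · exact this

/-- If adding `1` to `δ_i` destroys monotonicity, then `δ_{i+1} = δ_i`, and `δ_i + i` takes the
value of its successor. -/
theorem shiftedVandermonde_update_succ_eq_zero {K : ℕ} {δ : Fin K → ℕ} (hδ : Monotone δ)
    {i : Fin K} (h : ¬ Monotone (Function.update δ i (δ i + 1))) :
    shiftedVandermonde (Function.update δ i (δ i + 1)) = 0 := by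
  obtain ⟨j, hij, hj⟩ : ∃ j, i < j ∧ δ j ≤ δ i := by
    by_contra! hlt
    refine h fun a b hab => ?_
    have := hδ hab
    simp only [Function.update_apply]
    split_ifs with ha hb hb
    · rfl
    · subst ha
      exact hlt b (lt_of_le_of_ne hab (Ne.symm hb))
    · subst hb
      omega
    · exact this
  have hij' : (i : ℕ) < j := hij
  let k : Fin K := ⟨(i : ℕ) + 1, by omega⟩
  have hik : i < k := Fin.lt_def.2 (Nat.lt_succ_self _)
  have hkj : k ≤ j := Fin.le_def.2 hij'
  have hk : δ k = δ i := le_antisymm ((hδ hkj).trans hj) (hδ hik.le)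
  have hs : ((δ i + 1 : ℕ) : ℚ) + (i : ℕ) = shiftedParts δ k := by
    simp only [shiftedParts, hk, k]
    push_cast
    ring
  rw [shiftedVandermonde, shiftedParts_update, hs]
  exact det_vandermonde_update_eq_zero _ hik.ne

/-- The summand of a row without a corner vanishes: either `i` is the first index and `δ_i = 0`, or
`δ_{i-1} = δ_i` and two variables coincide after the shift. The shift is made in `ℚ`, so that it is
meaningful for `δ_i = 0` as well. -/
theorem shiftedParts_mul_det_vandermonde_eq_zero {K : ℕ} {δ : Fin K → ℕ} (hδ : Monotone δ)
    {i : Fin K} (h : ¬ IsRemovable δ i) :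
    shiftedParts δ i *
      (Matrix.vandermonde (Function.update (shiftedParts δ) i (shiftedParts δ i - 1))).det = 0 := by
  obtain ⟨i, hi⟩ := i
  cases i with
  | zero =>
    have : δ ⟨0, hi⟩ = 0 := by
      by_contra h0
      exact h ⟨Nat.pos_of_ne_zero h0, fun j hj => absurd (Fin.lt_def.1 hj) (Nat.not_lt_zero _)⟩
    simp [shiftedParts, this]
  | succ k =>
    have hlt : (⟨k, Nat.lt_of_succ_lt hi⟩ : Fin K) < ⟨k + 1, hi⟩ :=
      Fin.lt_def.2 (Nat.lt_succ_self _)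
    have hk : δ ⟨k, Nat.lt_of_succ_lt hi⟩ = δ ⟨k + 1, hi⟩ := by
      refine le_antisymm (hδ hlt.le) ?_
      by_contra! hne
      refine h ⟨by omega, fun j hj => lt_of_le_of_lt (hδ ?_) hne⟩
      exact Fin.le_def.2 (Nat.le_of_lt_succ hj)
    have hs : shiftedParts δ ⟨k + 1, hi⟩ - 1 = shiftedParts δ ⟨k, Nat.lt_of_succ_lt hi⟩ := by
      simp [shiftedParts, hk]
      ring
    rw [hs, det_vandermonde_update_eq_zero _ hlt.ne', mul_zero]

open Classical in
/-- The recurrence of the numbers of standard tableaux, for the quotient `Δ / ∏ (δ_i + i)!`; the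
factor `∑ δ_i` is absorbed into the factorial of the number of boxes. -/
theorem sum_isRemovable {K : ℕ} {δ : Fin K → ℕ} (hδ : Monotone δ) :
    ∑ i : Fin K, (if IsRemovable δ i then
        shiftedVandermonde (Function.update δ i (δ i - 1)) /
          shiftedFactorial (Function.update δ i (δ i - 1)) else 0) =
      (∑ i, δ i : ℕ) * (shiftedVandermonde δ / shiftedFactorial δ) := by
  have h := sum_mul_det_vandermonde_sub_one (shiftedParts δ)
  have hsum : ∑ i, (shiftedParts δ i - (i : ℕ)) = (∑ i, δ i : ℕ) := by
    simp [shiftedParts]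
  rw [hsum] at h
  rw [← mul_div_assoc, shiftedVandermonde, ← h, Finset.sum_div]
  refine Finset.sum_congr rfl fun i _ => ?_
  split_ifs with hi
  · have hpos := hi.1
    have hcast : ((δ i - 1 : ℕ) : ℚ) + (i : ℕ) = shiftedParts δ i - 1 := by
      rw [shiftedParts, Nat.cast_sub hpos]
      push_cast
      ring
    have hF := shiftedFactorial_update_succ (Function.update δ i (δ i - 1)) i
    rw [Function.update_idem, Function.update_self, Nat.sub_add_cancel hpos,
      Function.update_eq_self, shiftedParts_update, Function.update_self, hcast,
      sub_add_cancel] at hF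
    have hs : shiftedParts δ i ≠ 0 := fun h0 =>
      shiftedFactorial_ne_zero δ (by rw [hF, h0, zero_mul])
    rw [hF, shiftedVandermonde, shiftedParts_update, hcast, mul_div_mul_left _ _ hs]
  · rw [shiftedParts_mul_det_vandermonde_eq_zero hδ hi, zero_div]

theorem shiftedVandermonde_zero (K : ℕ) :
    shiftedVandermonde (fun _ : Fin K => 0) = ∏ i : Fin K, ((i : ℕ)! : ℚ) := by
  have e : shiftedParts (fun _ : Fin K => 0) = fun i : Fin K => ((i : ℕ) : ℚ) := by
    ext i; simp [shiftedParts]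
  rw [shiftedVandermonde, e]
  cases K with
  | zero => simp
  | succ n =>
    rw [Matrix.det_vandermonde_id_eq_superFactorial, ← Nat.prod_range_succ_factorial, Nat.cast_prod,
      Fin.prod_univ_eq_prod_range (fun i => (i ! : ℚ))]

theorem shiftedFactorial_zero (K : ℕ) :
    shiftedFactorial (fun _ : Fin K => 0) = ∏ i : Fin K, ((i : ℕ)! : ℚ) := by
  simp [shiftedFactorial]

open Classical in
/-- The recurrence `youngCount_succ` for the parts listed in increasing order. -/
theorem youngCount_rev_succ {K : ℕ} (δ : Fin K → ℕ) (r : ℕ) :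
    youngCount (fun i => δ i.rev) (r + 1) = ∑ i : Fin K,
      if IsRemovable δ i then
        youngCount (fun k => Function.update δ i (δ i - 1) k.rev) r else 0 := by
  rw [youngCount_succ, ← Equiv.sum_comp Fin.revPerm]
  refine Finset.sum_congr rfl fun i _ => ?_
  have hc : (0 < δ i ∧ ∀ j, i.rev < j → δ j.rev < δ i) ↔ IsRemovable δ i := by
    refine and_congr_right fun _ => ⟨fun h j hj => ?_, fun h j hj => h _ ?_⟩
    · simpa using h j.rev (Fin.rev_lt_rev.2 hj)
    · rwa [← Fin.rev_lt_rev, Fin.rev_rev]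
  have hu : Function.update (fun i => δ i.rev) i.rev (δ i - 1) =
      fun k : Fin K => Function.update δ i (δ i - 1) k.rev := by
    ext k
    rcases eq_or_ne k i.rev with rfl | h
    · simp
    · rw [Function.update_of_ne h, Function.update_of_ne]
      rintro rfl
      exact h (Fin.rev_rev k).symm
  simp only [Fin.revPerm_apply, Fin.rev_rev, hc, hu]

theorem sum_update_pred {K r : ℕ} {δ : Fin K → ℕ} {i : Fin K} (hi : 0 < δ i)
    (hs : ∑ k, δ k = r + 1) : ∑ k, Function.update δ i (δ i - 1) k = r := by
  have h := Finset.add_sum_erase Finset.univ δ (Finset.mem_univ i)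
  rw [Finset.sum_update_of_mem (Finset.mem_univ i), ← Finset.erase_eq]
  omega

theorem sum_update_succ {K r : ℕ} {δ : Fin K → ℕ} (i : Fin K)
    (hs : ∑ k, δ k = r) : ∑ k, Function.update δ i (δ i + 1) k = r + 1 := by
  have h := Finset.add_sum_erase Finset.univ δ (Finset.mem_univ i)
  rw [Finset.sum_update_of_mem (Finset.mem_univ i), ← Finset.erase_eq]
  omega

/-- The Frobenius-Young formula for the number of standard tableaux. -/
theorem youngCount_rev_eq {K : ℕ} (r : ℕ) (δ : Fin K → ℕ) (hδ : Monotone δ)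
    (hs : ∑ i, δ i = r) :
    (youngCount (fun i => δ i.rev) r : ℚ) =
      (r ! : ℚ) * (shiftedVandermonde δ / shiftedFactorial δ) := by
  classical
  induction r generalizing δ with
  | zero =>
    obtain rfl : δ = fun _ => 0 := funext fun i => by
      simpa using (Finset.sum_eq_zero_iff.1 hs) i (Finset.mem_univ i)
    rw [youngCount_zero, shiftedVandermonde_zero, ← shiftedFactorial_zero,
      div_self (shiftedFactorial_ne_zero _)]
    simp
  | succ r ih =>
    rw [youngCount_rev_succ, Nat.factorial_succ, mul_comm (r + 1), Nat.cast_mul, mul_assoc, ← hs,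
      ← sum_isRemovable hδ, Nat.cast_sum, Finset.mul_sum]
    refine Finset.sum_congr rfl fun i _ => ?_
    split_ifs with hi
    · exact ih _ (hδ.update_pred hi) (sum_update_pred hi.1 hs)
    · simp

/-! ### The sum of the squares -/

theorem mem_increasingTuples {K r : ℕ} {δ : Fin K → ℕ} :
    δ ∈ increasingTuples K r ↔ ∑ i, δ i = r ∧ Monotone δ := by
  rw [increasingTuples, Finset.mem_filter, Finset.Nat.mem_antidiagonalTuple]
  rfl

/-- Both sides are sums over the pairs of monotone tuples that differ by `1` in one entry. -/
theorem sum_sq_shiftedVandermonde_succ (K r : ℕ) :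
    (r + 1 : ℚ) * ∑ δ ∈ increasingTuples K (r + 1), shiftedVandermonde δ ^ 2 / shiftedFactorial δ =
      K * ∑ δ ∈ increasingTuples K r, shiftedVandermonde δ ^ 2 / shiftedFactorial δ := by
  classical
  have hl : ∀ δ ∈ increasingTuples K (r + 1),
      (r + 1 : ℚ) * (shiftedVandermonde δ ^ 2 / shiftedFactorial δ) =
      ∑ i, if IsRemovable δ i then shiftedVandermonde δ *
        (shiftedVandermonde (Function.update δ i (δ i - 1)) /
          shiftedFactorial (Function.update δ i (δ i - 1))) else 0 := by
    intro δ hδ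
    rw [mem_increasingTuples] at hδ
    have h := sum_isRemovable hδ.2
    rw [hδ.1] at h
    simp only [← mul_ite_zero, ← Finset.mul_sum, h]
    push_cast
    ring
  have hr : ∀ δ ∈ increasingTuples K r,
      K * (shiftedVandermonde δ ^ 2 / shiftedFactorial δ) =
      ∑ i, if Monotone (Function.update δ i (δ i + 1)) then
        shiftedVandermonde (Function.update δ i (δ i + 1)) *
          (shiftedVandermonde δ / shiftedFactorial δ) else 0 := by
    intro δ hδ
    rw [mem_increasingTuples] at hδ
    rw [pow_two, mul_div_assoc, ← mul_assoc, ← sum_shiftedVandermonde_update_succ, Finset.sum_mul]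
    refine Finset.sum_congr rfl fun i _ => ?_
    split_ifs with hi
    · rfl
    · rw [shiftedVandermonde_update_succ_eq_zero hδ.2 hi, zero_mul]
  rw [Finset.mul_sum, Finset.mul_sum, Finset.sum_congr rfl hl, Finset.sum_congr rfl hr,
    Finset.sum_comm, Finset.sum_comm (s := increasingTuples K r)]
  refine Finset.sum_congr rfl fun i _ => ?_
  rw [← Finset.sum_filter, ← Finset.sum_filter]
  -- For a fixed row `i`, removing a box from `i` and adding one to `i` are inverse to each other.
  refine Finset.sum_nbij' (fun δ => Function.update δ i (δ i - 1))
    (fun δ => Function.update δ i (δ i + 1)) ?_ ?_ ?_ ?_ ?_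
  · intro δ hδ
    rw [Finset.mem_filter, mem_increasingTuples] at hδ ⊢
    refine ⟨⟨sum_update_pred hδ.2.1 hδ.1.1, hδ.1.2.update_pred hδ.2⟩, ?_⟩
    simpa [Nat.sub_add_cancel hδ.2.1] using hδ.1.2
  · intro δ hδ
    rw [Finset.mem_filter, mem_increasingTuples] at hδ ⊢
    exact ⟨⟨sum_update_succ i hδ.1.1, hδ.2⟩, hδ.1.2.isRemovable_update_succ i⟩
  · intro δ hδ
    simp [Nat.sub_add_cancel (Finset.mem_filter.1 hδ).2.1]
  · intro δ hδ
    simp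
  · intro δ hδ
    simp [Nat.sub_add_cancel (Finset.mem_filter.1 hδ).2.1]

/-- The sum of `f^ν` times the number of semistandard tableaux of shape `ν` with `K` possible
entries is `K ^ r`, up to the common factor `∏ i!`. -/
theorem factorial_mul_sum_sq_shiftedVandermonde (K r : ℕ) :
    (r ! : ℚ) * ∑ δ ∈ increasingTuples K r, shiftedVandermonde δ ^ 2 / shiftedFactorial δ =
      (∏ i : Fin K, ((i : ℕ)! : ℚ)) * K ^ r := by
  induction r with
  | zero =>
    have h0 : increasingTuples K 0 = {fun _ => 0} := by
      ext δ
      rw [mem_increasingTuples, Finset.mem_singleton]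
      refine ⟨fun h => funext fun i => by
        simpa using (Finset.sum_eq_zero_iff.1 h.1) i (Finset.mem_univ i), ?_⟩
      rintro rfl
      exact ⟨by simp, fun _ _ _ => le_rfl⟩
    have := shiftedFactorial_ne_zero (fun _ : Fin K => 0)
    rw [h0, Finset.sum_singleton, shiftedVandermonde_zero, ← shiftedFactorial_zero]
    field_simp
    simp
  | succ r ih =>
    rw [Nat.factorial_succ, mul_comm (r + 1), Nat.cast_mul, mul_assoc]
    push_cast
    rw [sum_sq_shiftedVandermonde_succ, mul_left_comm, ih]
    ring

theorem secondIdentitySum_eq (K r : ℕ) :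
    secondIdentitySum K r = (r ! : ℚ) / (∏ i : Fin K, ((i : ℕ)! : ℚ)) *
      ∑ δ ∈ increasingTuples K r, shiftedVandermonde δ ^ 2 / shiftedFactorial δ := by
  simp only [secondIdentitySum, shiftedVandermonde_eq_prod, Finset.prod_pow, shiftedFactorial]

theorem secondIdentitySum_eq_pow (K r : ℕ) : secondIdentitySum K r = (K : ℚ) ^ r := by
  have h := shiftedFactorial_ne_zero (fun _ : Fin K => 0)
  rw [shiftedFactorial_zero] at h
  rw [secondIdentitySum_eq, div_mul_eq_mul_div, factorial_mul_sum_sq_shiftedVandermonde,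
    mul_div_cancel_left₀ _ h]

/-! ### The case of vanishing parameters -/

theorem admissible_zero (K r : ℕ) : admissible K (fun _ => 0) r = increasingTuples K r := by
  ext δ
  rw [mem_increasingTuples, admissible, Finset.mem_filter, Finset.Nat.mem_antidiagonalTuple]
  refine and_congr_right fun _ => ⟨fun h => ?_, fun h i j hij => h (Fin.le_def.2 (by omega))⟩
  cases K with
  | zero => exact fun i => i.elim0
  | succ n => exact Fin.monotone_iff_le_succ.2 fun i => h _ _ (by simp)

theorem barLambda_zero {K : ℕ} (i : Fin K) :
    barLambda (fun _ => 0) i = (K : ℤ) - 1 - (i : ℕ) := by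
  have h : barLambda (fun _ : Fin K => 0) i =
      ∑ m ∈ Finset.range K, if (i : ℕ) ≤ m ∧ m + 1 < K then (1 : ℤ) else 0 := by
    rw [← Fin.sum_univ_eq_sum_range (fun m => if (i : ℕ) ≤ m ∧ m + 1 < K then (1 : ℤ) else 0),
      barLambda, Finset.sum_filter]
    simp
  have hI : (Finset.range K).filter (fun m => (i : ℕ) ≤ m ∧ m + 1 < K) =
      Finset.Ico (i : ℕ) (K - 1) := by
    ext m
    simp only [Finset.mem_filter, Finset.mem_range, Finset.mem_Ico]
    omega
  have := i.2
  rw [h, ← Finset.sum_filter, hI]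
  simp
  omega

/-- The falling factorial vanishes exactly where `n - i` is negative. -/
theorem invFactorial_sub (n i : ℕ) :
    invFactorial ((n : ℤ) - i) = ((n ! : ℕ) : ℚ)⁻¹ * (descPochhammer ℚ i).eval (n : ℚ) := by
  rw [descPochhammer_eval_eq_descFactorial, invFactorial]
  rcases le_or_gt i n with h | h
  · have hn : ((n - i)! * n.descFactorial i : ℚ) = (n ! : ℕ) := by
      exact_mod_cast Nat.factorial_mul_descFactorial h
    have h1 : ((n - i)! : ℚ) ≠ 0 := Nat.cast_ne_zero.2 (Nat.factorial_ne_zero _)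
    have h2 : (n.descFactorial i : ℚ) ≠ 0 :=
      Nat.cast_ne_zero.2 (Nat.descFactorial_eq_zero_iff_lt.not.2 h.not_gt)
    rw [if_pos (by omega), ← hn, show ((n : ℤ) - i).toNat = n - i by omega]
    field_simp
  · rw [if_neg (by omega), Nat.descFactorial_of_lt h]
    simp

theorem det_skewMatrix_zero {K : ℕ} (δ : Fin K → ℕ) :
    (skewMatrix (fun _ => 0) δ).det = shiftedVandermonde δ / shiftedFactorial δ := by
  have h : skewMatrix (fun _ => 0) δ = Matrix.of fun i j : Fin K =>
      (((δ j + (j : ℕ))! : ℕ) : ℚ)⁻¹ * (Matrix.of fun j i : Fin K =>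
        (descPochhammer ℚ i).eval (shiftedParts δ j)).transpose i j := by
    ext i j
    have e : (δ j : ℤ) +
        (barLambda (fun _ => 0) i - barLambda (fun _ => 0) j - (i : ℤ) + (j : ℤ)) / 2 =
          ((δ j + (j : ℕ) : ℕ) : ℤ) - (i : ℕ) := by
      rw [barLambda_zero, barLambda_zero]
      omega
    rw [skewMatrix, Matrix.of_apply, e, invFactorial_sub]
    simp [shiftedParts]
  rw [h, Matrix.det_mul_row, Matrix.det_transpose, shiftedVandermonde,
    Matrix.det_eval_matrixOfPolynomials_eq_det_vandermonde _ (fun i : Fin K => descPochhammer ℚ i)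
      (fun i => descPochhammer_natDegree ℚ i) (fun i => monic_descPochhammer ℚ i),
    Finset.prod_inv_distrib, shiftedFactorial, div_eq_inv_mul]

theorem firstIdentitySum_zero (K r : ℕ) :
    firstIdentitySum K (fun _ => 0) r = secondIdentitySum K r := by
  rw [firstIdentitySum, secondIdentitySum_eq, admissible_zero, div_mul_eq_mul_div, mul_div_assoc,
    Finset.sum_div]
  congr 1
  refine Finset.sum_congr rfl fun δ _ => ?_
  rw [det_skewMatrix_zero, ← shiftedVandermonde_zero, shiftedVandermonde_eq_prod (fun _ => 0),
    ← Finset.prod_div_distrib]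
  simp only [← Finset.prod_div_distrib]
  have hfac : ∀ i : Fin K, ∀ j ∈ Finset.Ioi i,
      ((barLambda (fun _ => 0) i : ℚ) - barLambda (fun _ => 0) j - 2 * (δ i : ℚ) + 2 * (δ j : ℚ)
        - (i : ℕ) + (j : ℕ)) /
      ((barLambda (fun _ => 0) i : ℚ) - barLambda (fun _ => 0) j - (i : ℕ) + (j : ℕ)) =
      ((δ j : ℚ) - (δ i : ℚ) + (j : ℕ) - (i : ℕ)) /
        (((0 : ℕ) : ℚ) - ((0 : ℕ) : ℚ) + (j : ℕ) - (i : ℕ)) := by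
    intro i j _
    -- For `η = 0` numerator and denominator are twice the factors of the two Vandermonde products.
    rw [barLambda_zero, barLambda_zero,
      ← mul_div_mul_left _ (((0 : ℕ) : ℚ) - _ + _ - _) two_ne_zero]
    push_cast
    congr 1 <;> ring
  rw [Finset.prod_congr rfl fun i _ => Finset.prod_congr rfl (hfac i)]
  simp only [Finset.prod_div_distrib]
  rw [← shiftedVandermonde_eq_prod]
  ring

theorem skewCount_shape_zero {K r : ℕ} {δ : Fin K → ℕ} (hδ : Monotone δ) :
    skewCount (outerShape (fun _ => 0) δ) (innerShape (fun _ => 0) δ) r =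
      youngCount (fun i => δ i.rev) r := by
  have hlast : ∀ i, δ i ≤ lastEntry δ := by
    intro i
    rw [lastEntry, dif_pos i.pos]
    exact hδ (Fin.le_def.2 (by have := i.2; dsimp only; omega))
  refine skewCount_rotate r (lastEntry δ) (fun i => ?_) fun i => ?_
  · simp [outerShape]
  · have := hlast i
    simp [innerShape, outerShape]
    omega

/-! ### Two parts -/

theorem sum_increasingTuples_two (r : ℕ) (f : (Fin 2 → ℕ) → ℚ) :
    ∑ δ ∈ increasingTuples 2 r, f δ = ∑ q ∈ Finset.range (r / 2 + 1), f ![q, r - q] := by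
  refine Finset.sum_nbij' (fun δ => δ 0) (fun q => ![q, r - q]) ?_ ?_ ?_ ?_ ?_
  · intro δ hδ
    rw [mem_increasingTuples, Fin.sum_univ_two] at hδ
    have := hδ.2 (show (0 : Fin 2) ≤ 1 by decide)
    rw [Finset.mem_range]
    omega
  · intro q hq
    rw [Finset.mem_range] at hq
    rw [mem_increasingTuples, Fin.sum_univ_two, Fin.monotone_iff_le_succ]
    refine ⟨?_, fun i => ?_⟩
    · simp; omega
    · fin_cases i
      simp; omega
  · intro δ hδ
    rw [mem_increasingTuples, Fin.sum_univ_two] at hδ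
    ext i
    fin_cases i
    · simp
    · simp; omega
  · intro q _
    simp
  · intro δ hδ
    rw [mem_increasingTuples, Fin.sum_univ_two] at hδ
    congr 1
    ext i
    fin_cases i
    · simp
    · simp; omega

theorem secondIdentitySum_two (r : ℕ) :
    secondIdentitySum 2 r = (r ! : ℚ) * ∑ q ∈ Finset.range (r / 2 + 1),
      ((r : ℚ) - 2 * (q : ℚ) + 1) ^ 2 / ((q ! : ℚ) * ((r - q + 1)! : ℚ)) := by
  rw [secondIdentitySum_eq, sum_increasingTuples_two]
  congr 1
  · simp
  · refine Finset.sum_congr rfl fun q hq => ?_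
    rw [Finset.mem_range] at hq
    rw [shiftedVandermonde, Matrix.det_vandermonde, shiftedFactorial, Fin.prod_univ_two,
      Fin.prod_univ_two, show Finset.Ioi (0 : Fin 2) = {1} by decide,
      show Finset.Ioi (1 : Fin 2) = ∅ by decide]
    simp [shiftedParts, Nat.cast_sub (show q ≤ r by omega)]
    ring

/-! ### The identities -/

theorem mainTheorem3 (K r : ℕ) :
    -- the second combinatorial identity
    secondIdentitySum K r = (K : ℚ) ^ r ∧
    -- its left side is the one of the first identity, specialized to `η = 0`
    admissible K (fun _ => 0) r = increasingTuples K r ∧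
    firstIdentitySum K (fun _ => 0) r = secondIdentitySum K r ∧
    -- for `η = 0` the skew counts, and their determinants, reduce to `f^(δ_K, …, δ_1)`
    (∀ δ ∈ increasingTuples K r,
      skewCount (outerShape (fun _ => 0) δ) (innerShape (fun _ => 0) δ) r =
        youngCount (fun i => δ i.rev) r ∧
      (r ! : ℚ) * (skewMatrix (fun _ => 0) δ).det = (youngCount (fun i => δ i.rev) r : ℚ) ∧
      (youngCount (fun i => δ i.rev) r : ℚ) =
        (r ! : ℚ) * (∏ i : Fin K, ∏ j ∈ Finset.Ioi i,
            ((δ j : ℚ) - (δ i : ℚ) + (j : ℕ) - (i : ℕ))) /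
          ∏ i : Fin K, ((δ i + (i : ℕ))! : ℚ)) ∧
    -- the case `K = 2`, written out
    (r ! : ℚ) * ∑ q ∈ Finset.range (r / 2 + 1),
      ((r : ℚ) - 2 * (q : ℚ) + 1) ^ 2 / ((q ! : ℚ) * ((r - q + 1)! : ℚ)) = 2 ^ r := by
  refine ⟨secondIdentitySum_eq_pow K r, admissible_zero K r, firstIdentitySum_zero K r, ?_, ?_⟩
  · intro δ hδ
    rw [mem_increasingTuples] at hδ
    have h := youngCount_rev_eq r δ hδ.2 hδ.1
    refine ⟨skewCount_shape_zero hδ.2, ?_, ?_⟩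
    · rw [det_skewMatrix_zero, h]
    · rw [h, ← shiftedVandermonde_eq_prod, mul_div_assoc, shiftedFactorial]
  · rw [← secondIdentitySum_two, secondIdentitySum_eq_pow, Nat.cast_ofNat]
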